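/- Let $n\ge 1$. A signed permutation of $[n]=\{1,\dots,n\}$ is a bijection $\sigma$ of $\{-n,\dots,-1,1,\dots,n\}$ onto itself with $\sigma(-i)=-\sigma(i)$ for all $i$; write $\sigma_i=\sigma(i)$ for $i\in[n]$ and $\sigma_0=0$. Let $B_n$ be the set of all signed permutations of $[n]$, let $\mathsf{neg}(\sigma)=\#\{i\in[n]:\sigma_i<0\}$, $\mathsf{wex}(\sigma)=\#\{i\in[n]:\sigma_i\ge i\}$ and $\mathsf{fwex}(\sigma)=2\,\mathsf{wex}(\sigma)+\mathsf{neg}(\sigma)$, and let $D_n\subseteq B_n$ consist of the $\sigma$ for which $\mathsf{neg}(\sigma)$ is even. Let $B_n^*$ (respectively $D_n^*$) be the set of those $\sigma\in B_n$ (respectively $\sigma\in D_n$) with $\sigma_i\ne i$ for all $i\in[n]$. The descent set of $\sigma\in B_n$ is $\{i: 0\le i<n,\ \sigma_i>\sigma_{i+1}\}$, and the Springer number $S_n$ is the cardinality of the largest descent class of $B_n$, i.e. the maximum over $I\subseteq\{0,\dots,n-1\}$ of the number of $\sigma\in B_n$ with descent set $I$. Then \[ \sum_{\sigma\in B_n^{*}}(-1)^{\lfloor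 \mathsf{fwex}(\sigma)/2\rfloor}=(-1)^{\lfloor n/2\rfloor}S_n \] and \[ \sum_{\sigma\in D_n^{*}}(-1)^{\lfloor \mathsf{fwex}(\sigma)/2\rfloor}= \begin{cases}(-1)^{n/2}S_n & \text{if } n \text{ is even},\\ 0 & \text{if } n \text{ is odd}.\end{cases} \] -/

import Mathlib

namespace SignedPermutation

/-- The set `[±n] = {-n, …, -1, 1, …, n}`. -/
noncomputable def pmSet (n : ℕ) : Finset ℤ := (Finset.Icc (-(n : ℤ)) (n : ℤ)).erase 0

theorem neg_mem_pmSet {n : ℕ} {k : ℤ} (hk : k ∈ pmSet n) : -k ∈ pmSet n := by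
  simp only [pmSet, Finset.mem_erase, Finset.mem_Icc] at hk ⊢
  omega

theorem natCast_mem_pmSet {n i : ℕ} (h : 1 ≤ i ∧ i ≤ n) : (i : ℤ) ∈ pmSet n := by
  simp only [pmSet, Finset.mem_erase, Finset.mem_Icc]
  omega

/-- Negation `i ↦ -i` on `[±n]`. -/
noncomputable def negPM {n : ℕ} (k : pmSet n) : pmSet n := ⟨-k.1, neg_mem_pmSet k.2⟩

/-- `B n`: the signed permutations of `[n]`, i.e. the bijections `σ` of `[±n]` onto itself with
`σ (-i) = - σ i`. -/
noncomputable def B (n : ℕ) : Finset (Equiv.Perm (pmSet n)) :=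
  Finset.univ.filter fun σ => ∀ i, σ (negPM i) = negPM (σ i)

/-- The entries `σ_1, …, σ_n` of the window notation of `σ`; outside of `1 ≤ i ≤ n` the value is `0`,
in particular `σ_0 = 0`. -/
noncomputable def window {n : ℕ} (σ : Equiv.Perm (pmSet n)) (i : ℕ) : ℤ :=
  if h : 1 ≤ i ∧ i ≤ n then (σ ⟨(i : ℤ), natCast_mem_pmSet h⟩ : ℤ) else 0

/-- The number of negative entries. -/
noncomputable def neg {n : ℕ} (σ : Equiv.Perm (pmSet n)) : ℕ :=
  ((Finset.Icc 1 n).filter fun i : ℕ => window σ i < 0).card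

/-- The number of weak excedances, `#{i ∈ [n] : σ_i ≥ i}`. -/
noncomputable def wex {n : ℕ} (σ : Equiv.Perm (pmSet n)) : ℕ :=
  ((Finset.Icc 1 n).filter fun i : ℕ => (i : ℤ) ≤ window σ i).card

/-- The number of flag weak excedances. -/
noncomputable def fwex {n : ℕ} (σ : Equiv.Perm (pmSet n)) : ℕ := 2 * wex σ + neg σ

/-- `D n`: the even-signed permutations of `[n]`. -/
noncomputable def D (n : ℕ) : Finset (Equiv.Perm (pmSet n)) :=
  (B n).filter fun σ => Even (neg σ)

/-- The fixed points of `σ`: the `i ∈ [n]` with `σ_i = i`. -/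
noncomputable def fixedPts {n : ℕ} (σ : Equiv.Perm (pmSet n)) : Finset ℕ :=
  (Finset.Icc 1 n).filter fun i : ℕ => window σ i = (i : ℤ)

/-- `B_n^*`: the signed permutations of `[n]` without fixed points. -/
noncomputable def BStar (n : ℕ) : Finset (Equiv.Perm (pmSet n)) :=
  (B n).filter fun σ => fixedPts σ = ∅

/-- `D_n^*`: the even-signed permutations of `[n]` without fixed points. -/
noncomputable def DStar (n : ℕ) : Finset (Equiv.Perm (pmSet n)) :=
  (D n).filter fun σ => fixedPts σ = ∅

/-- The type B descent set `{i : 0 ≤ i < n, σ_i > σ_{i+1}}`, with `σ_0 = 0`. -/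
noncomputable def descentSet {n : ℕ} (σ : Equiv.Perm (pmSet n)) : Finset ℕ :=
  (Finset.range n).filter fun i => window σ (i + 1) < window σ i

/-- The descent class of `B_n` belonging to `I ⊆ {0, …, n-1}`. -/
noncomputable def descentClass (n : ℕ) (I : Finset ℕ) : Finset (Equiv.Perm (pmSet n)) :=
  (B n).filter fun σ => descentSet σ = I

/-- The Springer number `S_n = K(B_n)`: the cardinality of the largest descent class of `B_n`. -/
noncomputable def springer (n : ℕ) : ℕ :=
  (Finset.range n).powerset.sup fun I => (descentClass n I).card

end SignedPermutation

/-! Both identities are read off from one complex identity: summing `I ^ fwex σ` over `BStar n`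
gives `I ^ n * springer n` (`sum_BStar_I_pow_fwex`). Real plus imaginary part of `I ^ k` is `(-1) ^
(k / 2)`, which gives the first sum. The real part alone keeps the even `k`, and `fwex` and `neg`
have the same parity, which gives the second.

The complex identity equates both sides with `springerPoly n` at `1`. On one side, `I ^ fwex`
factors over positions, so signs can be summed independently over each permutation; this leaves `I ^
n` times a product of excedance weights, whose sum over permutations obeys the recurrence of
`springerPoly` (`sum_perm_prod_excedanceWeight`).

On the other side, removing the entry of largest absolute value from a signed word splits it in two,
and its sign is forced by any adjacent descent condition. This bounds every descent class by a
convolution recurrence, with equality for alternating patterns (`card_patternWords_zero`). The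
recurrence is the Leibniz rule for `f' = f * T`, `T' = 1 + T ^ 2`, where `f = 1 / (cos x - sin x)`
and `T = tan (x + π / 4)`, taken at `x = 0`. -/

/-! ### Derivative polynomials and their convolution recurrences -/

open Polynomial in
/-- The derivative polynomials of `1 / (cos x - sin x)`: with `y = tan (x + π / 4)`, the `n`-th
derivative of that function is the function times the `n`-th polynomial in `y`. -/
noncomputable def springerPoly : ℕ → ℤ[X]
  | 0 => 1
  | n + 1 => X * springerPoly n + (1 + X ^ 2) * derivative (springerPoly n)

open Polynomial in
/-- The derivative polynomials of the tangent. -/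
noncomputable def tanPoly : ℕ → ℤ[X]
  | 0 => X
  | n + 1 => (1 + X ^ 2) * derivative (tanPoly n)

open Polynomial Finset in
theorem springerPoly_succ_eq_sum (n : ℕ) :
    springerPoly (n + 1) =
      ∑ ij ∈ antidiagonal n, (n.choose ij.1 : ℤ[X]) * (springerPoly ij.1 * tanPoly ij.2) := by
  induction n with
  | zero => simp [springerPoly, tanPoly]
  | succ n ih =>
    rw [sum_antidiagonal_choose_succ_mul (fun i j => springerPoly i * tanPoly j), springerPoly, ih,
      derivative_sum, mul_sum, mul_sum, ← sum_add_distrib, ← sum_add_distrib]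
    refine sum_congr rfl fun ij hij => ?_
    have h := Nat.choose_symm_of_eq_add (mem_antidiagonal.1 hij).symm
    simp only [derivative_mul, derivative_natCast, springerPoly, tanPoly, h]
    ring

open Polynomial Finset in
theorem tanPoly_succ_eq_sum (n : ℕ) :
    tanPoly (n + 1) = (if n = 0 then 1 else 0) +
      ∑ ij ∈ antidiagonal n, (n.choose ij.1 : ℤ[X]) * (tanPoly ij.1 * tanPoly ij.2) := by
  induction n with
  | zero => simp [tanPoly]; ring
  | succ n ih =>
    rw [sum_antidiagonal_choose_succ_mul (fun i j => tanPoly i * tanPoly j), tanPoly, ih,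
      derivative_add, derivative_sum, mul_add, mul_sum, ← sum_add_distrib, if_neg (Nat.succ_ne_zero n)]
    congr 1
    · split_ifs <;> simp
    refine sum_congr rfl fun ij hij => ?_
    have h := Nat.choose_symm_of_eq_add (mem_antidiagonal.1 hij).symm
    simp only [derivative_mul, derivative_natCast, tanPoly, h]
    ring

/-- The Springer numbers, as values of derivative polynomials. -/
noncomputable def springerValue (n : ℕ) : ℤ := (springerPoly n).eval 1

/-- The values at `1` of the derivative polynomials of the tangent. -/
noncomputable def tanValue (n : ℕ) : ℤ := (tanPoly n).eval 1

open Finset in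
theorem sum_powerset_choose (S : Finset ℕ) (f : ℕ → ℕ → ℤ) :
    ∑ L ∈ S.powerset, f #L #(S \ L) = ∑ ij ∈ antidiagonal #S, ((#S).choose ij.1 : ℤ) * f ij.1 ij.2 := by
  rw [Nat.sum_antidiagonal_eq_sum_range_succ (fun i j => ((#S).choose i : ℤ) * f i j)]
  have := sum_powerset_apply_card (x := S) (fun i => f i (#S - i))
  simp only [nsmul_eq_mul] at this
  rw [Nat.succ_eq_add_one, ← this]
  refine sum_congr rfl fun L hL => ?_
  rw [card_sdiff_of_subset (mem_powerset.1 hL)]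

-- The binomial coefficients become a sum over subsets, to match the choice of the entries left of
-- the maximum in `card_patternWords`.
open Finset in
theorem springerValue_succ (S : Finset ℕ) :
    springerValue (#S + 1) = ∑ L ∈ S.powerset, springerValue #L * tanValue #(S \ L) := by
  rw [sum_powerset_choose S fun i j => springerValue i * tanValue j, springerValue,
    springerPoly_succ_eq_sum, Polynomial.eval_finsetSum]
  simp [springerValue, tanValue]

open Finset in
theorem tanValue_succ (S : Finset ℕ) :
    tanValue (#S + 1) = (if #S = 0 then 1 else 0) +
      ∑ L ∈ S.powerset, tanValue #L * tanValue #(S \ L) := by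
  rw [sum_powerset_choose S fun i j => tanValue i * tanValue j, tanValue,
    tanPoly_succ_eq_sum, Polynomial.eval_add, Polynomial.eval_finsetSum]
  congr 1
  · split_ifs <;> simp
  · simp [tanValue]

theorem springerValue_zero : springerValue 0 = 1 := by simp [springerValue, springerPoly]

theorem tanValue_zero : tanValue 0 = 1 := by simp [tanValue, tanPoly]

/-! ### Descent patterns of words -/

/-- The descents of the list `l` are the positions `i` with `χ i`. -/
def HasDescentPattern : (ℕ → Prop) → List ℤ → Prop
  | _, [] => True
  | _, [_] => True
  | χ, a :: b :: l => (b < a ↔ χ 0) ∧ HasDescentPattern (fun i => χ (i + 1)) (b :: l)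

theorem hasDescentPattern_iff_getElem (χ : ℕ → Prop) (l : List ℤ) :
    HasDescentPattern χ l ↔ ∀ (i : ℕ) (h : i + 1 < l.length), l[i + 1] < l[i] ↔ χ i := by
  induction l generalizing χ with
  | nil => simp [HasDescentPattern]
  | cons a l ih =>
    cases l with
    | nil => simp [HasDescentPattern]
    | cons b l =>
      rw [HasDescentPattern, ih]
      constructor
      · rintro ⟨h0, h⟩ i hi
        cases i with
        | zero => simpa using h0
        | succ i => exact h i (by simpa using hi)
      · intro h
        refine ⟨by simpa using h 0 (by simp), fun i hi => ?_⟩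
        exact h (i + 1) (by simpa using hi)

theorem hasDescentPattern_append_cons (χ : ℕ → Prop) (l r : List ℤ) (a : ℤ) :
    HasDescentPattern χ (l ++ a :: r) ↔
      HasDescentPattern χ (l ++ [a]) ∧ HasDescentPattern (fun i => χ (i + l.length)) (a :: r) := by
  induction l generalizing χ with
  | nil => simp [HasDescentPattern]
  | cons b l ih =>
    cases l with
    | nil => simp [HasDescentPattern]
    | cons c l =>
      simp only [List.cons_append, HasDescentPattern] at ih ⊢
      rw [ih, and_assoc]
      simp only [List.length_cons, add_assoc]

/-- Comparing the last entry with a neighbour of smaller absolute value depends only on the sign of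
the last entry. -/
theorem hasDescentPattern_concat {χ : ℕ → Prop} {l : List ℤ} {a : ℤ}
    (h : ∀ x ∈ l, x.natAbs < a.natAbs) :
    HasDescentPattern χ (l ++ [a]) ↔
      HasDescentPattern χ l ∧ (l.length = 0 ∨ (χ (l.length - 1) ↔ a < 0)) := by
  induction l generalizing χ with
  | nil => simp [HasDescentPattern]
  | cons b l ih =>
    cases l with
    | nil =>
      have hb := h b (by simp)
      have : a < b ↔ a < 0 := by omega
      simp [HasDescentPattern, this, iff_comm]
    | cons c l =>
      have := ih (χ := fun i => χ (i + 1)) fun x hx => h x (List.mem_cons_of_mem _ hx)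
      simp only [List.cons_append, HasDescentPattern] at this ⊢
      rw [this, and_assoc]
      simp

theorem hasDescentPattern_cons {χ : ℕ → Prop} {r : List ℤ} {a : ℤ}
    (h : ∀ x ∈ r, x.natAbs < a.natAbs) :
    HasDescentPattern χ (a :: r) ↔
      HasDescentPattern (fun i => χ (i + 1)) r ∧ (r.length = 0 ∨ (χ 0 ↔ 0 < a)) := by
  cases r with
  | nil => simp [HasDescentPattern]
  | cons c r =>
    have hb := h c (by simp)
    have : c < a ↔ 0 < a := by omega
    simp [HasDescentPattern, this, iff_comm, and_comm]

/-! ### Signed words and splitting at the entry of largest absolute value -/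

theorem finite_signedWords (S : Finset ℕ) :
    {w : List ℤ | ((w.map Int.natAbs : List ℕ) : Multiset ℕ) = S.val}.Finite := by
  have hT : ((Finset.Icc (-(S.sup id : ℕ) : ℤ) (S.sup id : ℕ) : Finset ℤ) : Set ℤ).Finite :=
    Finset.finite_toSet _
  have := hT.to_subtype
  have h2 := (List.finite_length_eq
    ((Finset.Icc (-(S.sup id : ℕ) : ℤ) (S.sup id : ℕ) : Finset ℤ) : Set ℤ) S.card).image
    (List.map Subtype.val)
  refine h2.subset fun w hw => ?_
  have hlen : w.length = S.card := by
    simpa using congrArg Multiset.card hw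
  have hmem : ∀ x ∈ w, x ∈ ((Finset.Icc (-(S.sup id : ℕ) : ℤ) (S.sup id : ℕ) : Finset ℤ) : Set ℤ) := by
    intro x hx
    have h1 : x.natAbs ∈ S := by
      rw [← Finset.mem_val, ← (show _ = S.val from hw)]
      exact Multiset.mem_coe.2 (List.mem_map_of_mem hx)
    have := Finset.le_sup (f := id) h1
    simp only [id] at this
    simp only [Finset.coe_Icc, Set.mem_Icc]
    omega
  refine ⟨w.attach.map fun x => ⟨x.1, hmem x.1 x.2⟩, by simpa using hlen, ?_⟩
  simp [List.map_map, Function.comp_def]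

/-- The words with entries `± s`, where every `s ∈ S` is used exactly once. -/
noncomputable def signedWords (S : Finset ℕ) : Finset (List ℤ) := (finite_signedWords S).toFinset

theorem mem_signedWords {S : Finset ℕ} {w : List ℤ} :
    w ∈ signedWords S ↔ ((w.map Int.natAbs : List ℕ) : Multiset ℕ) = S.val := by
  simp [signedWords]

theorem mem_signedWords_iff {S : Finset ℕ} {w : List ℤ} :
    w ∈ signedWords S ↔ (w.map Int.natAbs).Nodup ∧ ∀ k, k ∈ S ↔ k ∈ w.map Int.natAbs := by
  rw [mem_signedWords]
  constructor
  · intro h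
    refine ⟨by rw [← Multiset.coe_nodup, h]; exact S.nodup, fun k => ?_⟩
    rw [← Finset.mem_val, ← h, Multiset.mem_coe]
  · rintro ⟨h1, h2⟩
    rw [Multiset.Nodup.ext (Multiset.coe_nodup.2 h1) S.nodup]
    intro k
    rw [Finset.mem_val, h2, Multiset.mem_coe]

theorem natAbs_mem_of_mem_signedWords {S : Finset ℕ} {w : List ℤ} (h : w ∈ signedWords S) {x : ℤ}
    (hx : x ∈ w) : x.natAbs ∈ S :=
  ((mem_signedWords_iff.1 h).2 _).2 (List.mem_map_of_mem hx)

theorem length_of_mem_signedWords {S : Finset ℕ} {w : List ℤ} (h : w ∈ signedWords S) :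
    w.length = S.card := by
  simpa using congrArg Multiset.card (mem_signedWords.1 h)

open Classical in
/-- The words `w` on `S` for which `p ++ w` has descent pattern `χ`. -/
noncomputable def patternWords (p : List ℤ) (χ : ℕ → Prop) (S : Finset ℕ) : Finset (List ℤ) :=
  (signedWords S).filter fun w => HasDescentPattern χ (p ++ w)

open Classical in
/-- The signs that an entry `± M` of largest absolute value may have, if `a` entries precede it and
`b` entries follow it. -/
noncomputable def extremeEntries (χ : ℕ → Prop) (M a b : ℕ) : Finset ℤ :=
  ({(M : ℤ), -(M : ℤ)} : Finset ℤ).filter fun e =>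
    (a = 0 ∨ (χ (a - 1) ↔ e < 0)) ∧ (b = 0 ∨ (χ a ↔ 0 < e))

theorem append_cons_inj_of_forall {α : Type*} {P : α → Prop} {l l' r r' : List α} {e e' : α}
    (hl : ∀ x ∈ l, ¬ P x) (hl' : ∀ x ∈ l', ¬ P x) (he : P e) (he' : P e')
    (h : l ++ e :: r = l' ++ e' :: r') : l = l' ∧ e = e' ∧ r = r' := by
  induction l generalizing l' with
  | nil =>
    cases l' with
    | nil => simpa using h
    | cons b l' =>
      simp only [List.nil_append, List.cons_append, List.cons.injEq] at h
      exact absurd (h.1 ▸ he) (hl' b (by simp))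
  | cons a l ih =>
    cases l' with
    | nil =>
      simp only [List.nil_append, List.cons_append, List.cons.injEq] at h
      exact absurd (h.1 ▸ he') (hl a (by simp))
    | cons b l' =>
      simp only [List.cons_append, List.cons.injEq] at h
      obtain ⟨h1, h2⟩ := h
      obtain ⟨h3, h4⟩ := ih (fun x hx => hl x (List.mem_cons_of_mem _ hx))
        (fun x hx => hl' x (List.mem_cons_of_mem _ hx)) h2
      exact ⟨by rw [h1, h3], h4⟩

theorem append_cons_mem_signedWords {S L : Finset ℕ} {M : ℕ} (hM : M ∈ S) (hL : L ⊆ S.erase M)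
    {l r : List ℤ} {e : ℤ} (hl : l ∈ signedWords L) (hr : r ∈ signedWords (S.erase M \ L))
    (he : e.natAbs = M) : l ++ e :: r ∈ signedWords S := by
  rw [mem_signedWords] at *
  rw [List.map_append, List.map_cons, ← Multiset.coe_add, ← Multiset.cons_coe, hl, hr, he,
    Multiset.add_cons]
  rw [← Multiset.cons_erase (show M ∈ S.val from hM), ← Finset.erase_val, Finset.sdiff_val,
    add_tsub_cancel_of_le (Finset.val_le_iff.2 hL)]

theorem hasDescentPattern_split {p l r : List ℤ} {e : ℤ} (χ : ℕ → Prop)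
    (hp : ∀ x ∈ p, x.natAbs < e.natAbs) (hl : ∀ x ∈ l, x.natAbs < e.natAbs)
    (hr : ∀ x ∈ r, x.natAbs < e.natAbs) :
    HasDescentPattern χ (p ++ (l ++ e :: r)) ↔ HasDescentPattern χ (p ++ l) ∧
      HasDescentPattern (fun i => χ (i + (p.length + l.length + 1))) r ∧
      (p.length + l.length = 0 ∨ (χ (p.length + l.length - 1) ↔ e < 0)) ∧
      (r.length = 0 ∨ (χ (p.length + l.length) ↔ 0 < e)) := by
  rw [← List.append_assoc, hasDescentPattern_append_cons, hasDescentPattern_concat,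
    hasDescentPattern_cons hr]
  · simp only [List.length_append, zero_add, add_assoc, add_comm 1]
    tauto
  · intro x hx
    rcases List.mem_append.1 hx with h | h
    · exact hp x h
    · exact hl x h

-- A word corresponds to the set `L` of absolute values left of `± M`, the two subwords, and the
-- sign of `M`. The prefix `p` stays with the left subword; the right one sees `χ` shifted.
open Finset in
theorem card_patternWords (p : List ℤ) (χ : ℕ → Prop) {S : Finset ℕ} {M : ℕ} (hM : M ∈ S)
    (hmax : ∀ x ∈ S, x ≤ M) (hp : ∀ x ∈ p, x.natAbs < M) :
    #(patternWords p χ S) = ∑ L ∈ (S.erase M).powerset, #(patternWords p χ L) *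
      #(patternWords [] (fun i => χ (i + (p.length + #L + 1))) (S.erase M \ L)) *
      #(extremeEntries χ M (p.length + #L) #(S.erase M \ L)) := by
  classical
  have hlt : ∀ x ∈ S.erase M, x < M := fun x hx =>
    lt_of_le_of_ne (hmax x (mem_of_mem_erase hx)) (ne_of_mem_erase hx)
  simp_rw [← card_product]
  rw [← card_sigma]
  symm
  have key : ∀ a ∈ ((S.erase M).powerset.sigma fun L => (patternWords p χ L ×ˢ
      patternWords [] (fun i => χ (i + (p.length + #L + 1))) (S.erase M \ L)) ×ˢ
      extremeEntries χ M (p.length + #L) #(S.erase M \ L)),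
      a.1 ⊆ S.erase M ∧ a.2.1.1 ∈ signedWords a.1 ∧ a.2.1.2 ∈ signedWords (S.erase M \ a.1) ∧
      a.2.2.natAbs = M ∧ (∀ x ∈ a.2.1.1, x.natAbs < M) ∧ (∀ x ∈ a.2.1.2, x.natAbs < M) := by
    rintro ⟨L, ⟨l, r⟩, e⟩ h
    simp only [mem_sigma, mem_powerset, mem_product, patternWords, extremeEntries, mem_filter,
      mem_insert, mem_singleton] at h
    obtain ⟨hL, ⟨⟨hl, -⟩, ⟨hr, -⟩⟩, he, -⟩ := h
    refine ⟨hL, hl, hr, by simp only; omega, fun x hx => ?_, fun x hx => ?_⟩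
    · exact hlt _ (hL (natAbs_mem_of_mem_signedWords hl hx))
    · exact hlt _ (sdiff_subset (natAbs_mem_of_mem_signedWords hr hx))
  refine card_bij (fun a _ => a.2.1.1 ++ a.2.2 :: a.2.1.2) ?_ ?_ ?_
  · intro a ha
    obtain ⟨hL, hl, hr, he, hl', hr'⟩ := key a ha
    obtain ⟨L, ⟨l, r⟩, e⟩ := a
    simp only at *
    rw [patternWords, mem_filter, hasDescentPattern_split χ (by rwa [he]) (by rwa [he]) (by rwa [he])]
    refine ⟨append_cons_mem_signedWords hM hL hl hr he, ?_⟩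
    simp only [mem_sigma, mem_powerset, mem_product, patternWords, extremeEntries, mem_filter] at ha
    rw [length_of_mem_signedWords hl, length_of_mem_signedWords hr]
    exact ⟨ha.2.1.1.2, ha.2.1.2.2, ha.2.2.2⟩
  · intro a ha b hb hab
    obtain ⟨-, hl, -, he, hl', -⟩ := key a ha
    obtain ⟨-, hm, -, hf, hm', -⟩ := key b hb
    obtain ⟨L, ⟨l, r⟩, e⟩ := a
    obtain ⟨L', ⟨m, s⟩, f⟩ := b
    simp only at *
    obtain ⟨rfl, rfl, rfl⟩ := append_cons_inj_of_forall (P := fun x : ℤ => x.natAbs = M)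
      (fun x hx => (hl' x hx).ne) (fun x hx => (hm' x hx).ne) he hf hab
    obtain rfl : L = L' := by
      ext k
      rw [(mem_signedWords_iff.1 hl).2, (mem_signedWords_iff.1 hm).2]
    rfl
  · intro w hw
    rw [patternWords, mem_filter] at hw
    obtain ⟨hw, hpat⟩ := hw
    obtain ⟨e, hew, he⟩ := List.mem_map.1 (((mem_signedWords_iff.1 hw).2 M).1 hM)
    obtain ⟨l, r, rfl⟩ := List.append_of_mem hew
    obtain ⟨hnd, hmem⟩ := mem_signedWords_iff.1 hw
    simp only [List.map_append, List.map_cons, List.nodup_append, List.nodup_cons] at hnd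
    obtain ⟨hnl, ⟨her, hnr⟩, hdis⟩ := hnd
    have hl : l ∈ signedWords (l.map Int.natAbs).toFinset :=
      mem_signedWords_iff.2 ⟨hnl, by simp⟩
    have hLS : (l.map Int.natAbs).toFinset ⊆ S.erase M := by
      intro k hk
      rw [List.mem_toFinset] at hk
      refine mem_erase.2 ⟨?_, (hmem k).2 (by simp only [List.map_append]; exact List.mem_append_left _ hk)⟩
      rw [← he]
      exact hdis k hk _ List.mem_cons_self
    have hr : r ∈ signedWords (S.erase M \ (l.map Int.natAbs).toFinset) := by
      refine mem_signedWords_iff.2 ⟨hnr, fun k => ?_⟩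
      rw [mem_sdiff, mem_erase, hmem, List.mem_toFinset, List.map_append, List.mem_append,
        List.map_cons, List.mem_cons, he]
      constructor
      · tauto
      · intro hk
        refine ⟨⟨?_, by tauto⟩, fun hk' => hdis k hk' k (List.mem_cons_of_mem _ hk) rfl⟩
        rintro rfl
        exact her (he ▸ hk)
    have hl' : ∀ x ∈ l, x.natAbs < M := fun x hx => hlt _ (hLS (natAbs_mem_of_mem_signedWords hl hx))
    have hr' : ∀ x ∈ r, x.natAbs < M :=
      fun x hx => hlt _ (sdiff_subset (natAbs_mem_of_mem_signedWords hr hx))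
    rw [hasDescentPattern_split χ (by rwa [he]) (by rwa [he]) (by rwa [he])] at hpat
    refine ⟨⟨(l.map Int.natAbs).toFinset, (l, r), e⟩, ?_, rfl⟩
    simp only [mem_sigma, mem_powerset, mem_product, patternWords, extremeEntries, mem_filter,
      mem_insert, mem_singleton]
    rw [← length_of_mem_signedWords hl, ← length_of_mem_signedWords hr]
    exact ⟨hLS, ⟨⟨hl, hpat.1⟩, hr, hpat.2.1⟩, by omega, hpat.2.2⟩

/-! ### The alternating descent class is largest -/

open Finset in
theorem card_extremeEntries_le (χ : ℕ → Prop) (M : ℕ) {a b : ℕ} (h : 0 < a + b) :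
    #(extremeEntries χ M a b) ≤ 1 := by
  refine card_le_one.2 fun x hx y hy => ?_
  simp only [extremeEntries, mem_filter, mem_insert, mem_singleton] at hx hy
  by_cases ha : a = 0
  · have hb : b ≠ 0 := by omega
    simp only [hb, false_or] at hx hy
    have := hx.2.2.symm.trans hy.2.2
    omega
  · simp only [ha, false_or] at hx hy
    have := hx.2.1.symm.trans hy.2.1
    omega

open Finset in
theorem card_extremeEntries_zero (χ : ℕ → Prop) {M : ℕ} (hM : 0 < M) :
    #(extremeEntries χ M 0 0) = 2 := by
  simp only [extremeEntries, true_or, and_self, filter_true]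
  exact card_pair (by omega)

-- In an alternating pattern the conditions from the two sides agree: a positive `M` is a peak, a
-- negative one a valley.
open Finset in
theorem card_extremeEntries_of_alternating {χ : ℕ → Prop} (hχ : ∀ i, χ (i + 1) ↔ ¬ χ i) {M : ℕ}
    (hM : 0 < M) {a b : ℕ} (h : 0 < a + b) : #(extremeEntries χ M a b) = 1 := by
  refine le_antisymm (card_extremeEntries_le χ M h) (card_pos.2 ?_)
  by_cases hc : χ a
  · refine ⟨M, ?_⟩
    simp only [extremeEntries, mem_filter, mem_insert, mem_singleton, true_or, true_and]
    refine ⟨?_, Or.inr (by simpa [hc] using hM)⟩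
    cases a with
    | zero => simp
    | succ a =>
      have := (hχ a).1 hc
      right
      simp [this]
  · refine ⟨-M, ?_⟩
    simp only [extremeEntries, mem_filter, mem_insert, mem_singleton, or_true, true_and]
    refine ⟨?_, Or.inr (by simp [hc])⟩
    cases a with
    | zero => simp
    | succ a =>
      have : χ a := by
        by_contra h'
        exact hc ((hχ a).2 h')
      right
      simpa [this] using hM

open Finset in
theorem patternWords_empty (χ : ℕ → Prop) {p : List ℤ} (hp : HasDescentPattern χ p) :
    #(patternWords p χ ∅) = 1 := by
  rw [card_eq_one]
  refine ⟨[], ?_⟩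
  ext w
  simp only [patternWords, mem_filter, mem_singleton, mem_signedWords]
  constructor
  · rintro ⟨h, -⟩
    simpa using h
  · rintro rfl
    simpa using hp

-- Strong induction on the size, removing the largest entry. A one-letter word has no neighbour to
-- fix its sign, so it counts twice; this is the extra `1` in `tanValue_succ`.
open Finset in
theorem card_patternWords_nil (n : ℕ) : ∀ (S : Finset ℕ) (χ : ℕ → Prop), #S = n → (∀ x ∈ S, 0 < x) →
    (#(patternWords [] χ S) : ℤ) ≤ tanValue n ∧
    ((∀ i, χ (i + 1) ↔ ¬ χ i) → (#(patternWords [] χ S) : ℤ) = tanValue n) := by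
  induction n using Nat.strong_induction_on with
  | _ n ih =>
  intro S χ hS hpos
  rcases S.eq_empty_or_nonempty with rfl | hne
  · rw [patternWords_empty χ (by simp [HasDescentPattern]), ← hS]
    simp [tanValue_zero]
  have hM := S.max'_mem hne
  have hMpos := hpos _ hM
  have hcard : #(S.erase (S.max' hne)) + 1 = n := by rw [card_erase_add_one hM, hS]
  have hrec := card_patternWords [] χ hM (fun x hx => S.le_max' x hx) (by simp)
  set M := S.max' hne
  set T := S.erase M
  have hTpos : ∀ x ∈ T, 0 < x := fun x hx => hpos x (mem_of_mem_erase hx)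
  rcases T.eq_empty_or_nonempty with hT | hT
  · have hn : n = #(∅ : Finset ℕ) + 1 := by rw [← hcard, hT]
    rw [hn, tanValue_succ, hrec, hT]
    simp [patternWords_empty _ (show HasDescentPattern _ [] by simp [HasDescentPattern]),
      card_extremeEntries_zero χ hMpos, tanValue_zero]
  have hT0 : #T ≠ 0 := hT.card_pos.ne'
  rw [← hcard, tanValue_succ, if_neg hT0, zero_add, hrec]
  push_cast
  have hsub : ∀ L ∈ T.powerset, #L < n ∧ #(T \ L) < n ∧ 0 < ([] : List ℤ).length + #L + #(T \ L) := by
    intro L hL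
    have h1 := card_le_card (mem_powerset.1 hL)
    have h2 := card_sdiff_of_subset (mem_powerset.1 hL)
    simp only [List.length_nil]
    omega
  have hLpos : ∀ L ∈ T.powerset, ∀ x ∈ L, 0 < x := fun L hL x hx => hTpos x (mem_powerset.1 hL hx)
  have hRpos : ∀ L, ∀ x ∈ T \ L, 0 < x := fun L x hx => hTpos x (sdiff_subset hx)
  constructor
  · refine sum_le_sum fun L hL => ?_
    obtain ⟨h1, h2, h3⟩ := hsub L hL
    have e1 := (ih _ h1 L χ rfl (hLpos L hL)).1
    have e2 := (ih _ h2 (T \ L) (fun i => χ (i + (([] : List ℤ).length + #L + 1))) rfl (hRpos L)).1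
    have e3 : (#(extremeEntries χ M (([] : List ℤ).length + #L) #(T \ L)) : ℤ) ≤ 1 := by
      exact_mod_cast card_extremeEntries_le χ M h3
    refine (mul_le_of_le_one_right (by positivity) e3).trans ?_
    exact mul_le_mul e1 e2 (by positivity) ((Nat.cast_nonneg _).trans e1)
  · intro hχ
    refine sum_congr rfl fun L hL => ?_
    obtain ⟨h1, h2, h3⟩ := hsub L hL
    rw [(ih _ h1 L χ rfl (hLpos L hL)).2 hχ, (ih _ h2 (T \ L) _ rfl (hRpos L)).2,
      card_extremeEntries_of_alternating hχ hMpos h3]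
    · simp
    -- Alternation survives the shift of `χ` for the right subword.
    · intro i
      rw [← hχ]
      simp only [add_right_comm]

-- The leading `0` is always a neighbour on the left, so no sign is ever free. The right subword has
-- no prefix, hence the factor `tanValue`.
open Finset in
theorem card_patternWords_zero (n : ℕ) : ∀ (S : Finset ℕ) (χ : ℕ → Prop), #S = n →
    (∀ x ∈ S, 0 < x) → (#(patternWords [0] χ S) : ℤ) ≤ springerValue n ∧
    ((∀ i, χ (i + 1) ↔ ¬ χ i) → (#(patternWords [0] χ S) : ℤ) = springerValue n) := by
  induction n using Nat.strong_induction_on with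
  | _ n ih =>
  intro S χ hS hpos
  rcases S.eq_empty_or_nonempty with rfl | hne
  · rw [patternWords_empty χ (by simp [HasDescentPattern]), ← hS]
    simp [springerValue_zero]
  have hM := S.max'_mem hne
  have hMpos := hpos _ hM
  have hcard : #(S.erase (S.max' hne)) + 1 = n := by rw [card_erase_add_one hM, hS]
  have hrec := card_patternWords [0] χ hM (fun x hx => S.le_max' x hx) (by simpa using hMpos)
  set M := S.max' hne
  set T := S.erase M
  have hTpos : ∀ x ∈ T, 0 < x := fun x hx => hpos x (mem_of_mem_erase hx)
  rw [← hcard, springerValue_succ, hrec]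
  push_cast
  have hsub : ∀ L ∈ T.powerset, #L < n := by
    intro L hL
    have h1 := card_le_card (mem_powerset.1 hL)
    omega
  have h3 : ∀ L : Finset ℕ, 0 < ([0] : List ℤ).length + #L + #(T \ L) := by
    intro L
    simp only [List.length_singleton]
    omega
  have hLpos : ∀ L ∈ T.powerset, ∀ x ∈ L, 0 < x := fun L hL x hx => hTpos x (mem_powerset.1 hL hx)
  have hRpos : ∀ L, ∀ x ∈ T \ L, 0 < x := fun L x hx => hTpos x (sdiff_subset hx)
  constructor
  · refine sum_le_sum fun L hL => ?_
    have e1 := (ih _ (hsub L hL) L χ rfl (hLpos L hL)).1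
    have e2 := (card_patternWords_nil _ (T \ L) (fun i => χ (i + (([0] : List ℤ).length + #L + 1)))
      rfl (hRpos L)).1
    have e3 : (#(extremeEntries χ M (([0] : List ℤ).length + #L) #(T \ L)) : ℤ) ≤ 1 := by
      exact_mod_cast card_extremeEntries_le χ M (h3 L)
    refine (mul_le_of_le_one_right (by positivity) e3).trans ?_
    exact mul_le_mul e1 e2 (by positivity) ((Nat.cast_nonneg _).trans e1)
  · intro hχ
    refine sum_congr rfl fun L hL => ?_
    rw [(ih _ (hsub L hL) L χ rfl (hLpos L hL)).2 hχ, (card_patternWords_nil _ (T \ L) _ rfl (hRpos L)).2,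
      card_extremeEntries_of_alternating hχ hMpos (h3 L)]
    · simp
    · intro i
      rw [← hχ]
      simp only [add_right_comm]

/-! ### Excedance weights over permutations -/

open Polynomial in
/-- The weight of the pair `(i, j)`: `X + I` for an excedance, `X - I` for an anti-excedance and `X`
for a fixed point. -/
noncomputable def excedanceWeight {n : ℕ} (i j : Fin n) : ℂ[X] :=
  if i < j then X + C Complex.I else if j < i then X - C Complex.I else X

open Polynomial in
theorem derivative_excedanceWeight {n : ℕ} (i j : Fin n) :
    derivative (excedanceWeight i j) = 1 := by
  unfold excedanceWeight
  split_ifs <;> simp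

theorem excedanceWeight_succ {n : ℕ} (i j : Fin n) :
    excedanceWeight i.succ j.succ = excedanceWeight i j := by
  simp [excedanceWeight]

open Polynomial in
theorem excedanceWeight_zero_succ_mul {n : ℕ} (i j : Fin n) :
    excedanceWeight 0 i.succ * excedanceWeight j.succ 0 = 1 + X ^ 2 := by
  have h : (C Complex.I : ℂ[X]) * C Complex.I = -1 := by
    rw [← C_mul, Complex.I_mul_I, C_neg, C_1]
  simp only [excedanceWeight, Fin.succ_pos, if_true, Fin.not_lt_zero, if_false]
  linear_combination -h

-- A new smallest point `0` is either fixed, with weight `X`, or inserted into an arc `j → e j`.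
-- Insertion replaces that arc's weight by `(X + I) * (X - I) = 1 + X ^ 2`; since each weight has
-- derivative `1`, summing over arcs gives `(1 + X ^ 2)` times the derivative.
open Polynomial in
theorem sum_perm_prod_excedanceWeight (n : ℕ) :
    ∑ e : Equiv.Perm (Fin n), ∏ i, excedanceWeight i (e i) =
      (springerPoly n).map (Int.castRingHom ℂ) := by
  induction n with
  | zero => simp [springerPoly]
  | succ n ih =>
    rw [← Equiv.sum_comp Equiv.Perm.decomposeFin.symm, Fintype.sum_prod_type_right]
    rw [springerPoly, Polynomial.map_add, Polynomial.map_mul, Polynomial.map_mul,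
      ← Polynomial.derivative_map, ← ih, derivative_sum, Finset.mul_sum, Finset.mul_sum,
      ← Finset.sum_add_distrib]
    refine Finset.sum_congr rfl fun e _ => ?_
    -- Reindexing by `e` labels the nonzero image of `0` by the source `j` of the broken arc.
    rw [Fin.sum_univ_succ, ← Equiv.sum_comp e, derivative_prod_finset, Finset.mul_sum]
    congr 1
    · rw [Fin.prod_univ_succ]
      simp [Equiv.Perm.decomposeFin_symm_apply_succ, excedanceWeight_succ,
        Equiv.Perm.decomposeFin_symm_apply_zero]
      left
      simp [excedanceWeight]
    · refine Finset.sum_congr rfl fun j _ => ?_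
      rw [Fin.prod_univ_succ, Equiv.Perm.decomposeFin_symm_apply_zero,
        ← Finset.mul_prod_erase _ _ (Finset.mem_univ j), Equiv.Perm.decomposeFin_symm_apply_succ,
        Equiv.swap_apply_right, ← mul_assoc, excedanceWeight_zero_succ_mul,
        derivative_excedanceWeight, mul_one]
      congr 1
      · simp
      · refine Finset.prod_congr rfl fun i hi => ?_
        rw [Equiv.Perm.decomposeFin_symm_apply_succ, Equiv.swap_apply_of_ne_of_ne
          (Fin.succ_ne_zero _), excedanceWeight_succ]
        simpa using Finset.ne_of_mem_erase hi

/-! ### Window notation and descent classes -/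

namespace SignedPermutation

open Finset

/-- The sequences that are the window notation of a signed permutation. -/
def IsWindow {n : ℕ} (v : Fin n → ℤ) : Prop :=
  (∀ i, 1 ≤ (v i).natAbs ∧ (v i).natAbs ≤ n) ∧ Function.Injective fun i => (v i).natAbs

theorem mem_pmSet {n : ℕ} {k : ℤ} : k ∈ pmSet n ↔ 1 ≤ k.natAbs ∧ k.natAbs ≤ n := by
  simp only [pmSet, mem_erase, mem_Icc]
  omega

theorem window_succ {n : ℕ} (σ : Equiv.Perm (pmSet n)) (i : Fin n) :
    window σ (i + 1) = σ ⟨((i : ℕ) + 1 : ℕ), natCast_mem_pmSet ⟨by omega, by omega⟩⟩ :=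
  dif_pos ⟨by omega, by omega⟩

theorem isWindow_window {n : ℕ} {σ : Equiv.Perm (pmSet n)} (hσ : σ ∈ B n) :
    IsWindow fun i : Fin n => window σ (i + 1) := by
  refine ⟨fun i => ?_, fun i j hij => ?_⟩
  · simp only [window_succ]
    exact mem_pmSet.1 (σ _).2
  · have hσ' := (mem_filter.1 hσ).2
    simp only [window_succ] at hij
    rcases Int.natAbs_eq_natAbs_iff.1 hij with h | h
    · have := congrArg Subtype.val (σ.injective (Subtype.ext h))
      simp only at this
      omega
    · have h' : σ ⟨((i : ℕ) + 1 : ℕ), natCast_mem_pmSet ⟨by omega, by omega⟩⟩ =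
          negPM (σ ⟨((j : ℕ) + 1 : ℕ), natCast_mem_pmSet ⟨by omega, by omega⟩⟩) := Subtype.ext h
      rw [← hσ'] at h'
      have := congrArg Subtype.val (σ.injective h')
      simp only [negPM] at this
      omega

theorem eq_of_window_eq {n : ℕ} {σ τ : Equiv.Perm (pmSet n)} (hσ : σ ∈ B n) (hτ : τ ∈ B n)
    (h : ∀ i : Fin n, window σ (i + 1) = window τ (i + 1)) : σ = τ := by
  have hσ' := (mem_filter.1 hσ).2
  have hτ' := (mem_filter.1 hτ).2
  have key : ∀ k : pmSet n, 0 < k.1 → σ k = τ k := by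
    rintro ⟨k, hk⟩ hpos
    have hk' := mem_pmSet.1 hk
    have := h ⟨k.natAbs - 1, by omega⟩
    rw [window_succ, window_succ] at this
    have e : (((k.natAbs - 1) + 1 : ℕ) : ℤ) = k := by simp only at hpos; omega
    simp only [e] at this
    exact Subtype.ext this
  ext1 k
  rcases lt_trichotomy k.1 0 with hk | hk | hk
  · have e : k = negPM (negPM k) := Subtype.ext (by simp [negPM])
    rw [e, hσ', hτ', key (negPM k) (by simpa [negPM] using hk)]
  · have := mem_pmSet.1 k.2
    omega
  · exact key k hk

theorem exists_window_eq {n : ℕ} {v : Fin n → ℤ} (hv : IsWindow v) :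
    ∃ σ ∈ B n, ∀ i : Fin n, window σ (i + 1) = v i := by
  have hidx : ∀ k : pmSet n, k.1.natAbs - 1 < n := fun k => by
    have := mem_pmSet.1 k.2
    omega
  have hmem : ∀ k : pmSet n, k.1.sign * v ⟨k.1.natAbs - 1, hidx k⟩ ∈ pmSet n := fun k => by
    have h1 := mem_pmSet.1 k.2
    have h2 : k.1.sign.natAbs = 1 := Int.natAbs_sign_of_ne_zero (by omega)
    rw [mem_pmSet, Int.natAbs_mul, h2, one_mul]
    exact hv.1 _
  have hinj : Function.Injective fun k : pmSet n =>
      (⟨k.1.sign * v ⟨k.1.natAbs - 1, hidx k⟩, hmem k⟩ : pmSet n) := by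
    intro k l hkl
    have hk := mem_pmSet.1 k.2
    have hl := mem_pmSet.1 l.2
    have hkl' := congrArg Subtype.val hkl
    simp only at hkl'
    have hk2 : k.1.sign.natAbs = 1 := Int.natAbs_sign_of_ne_zero (by omega)
    have hl2 : l.1.sign.natAbs = 1 := Int.natAbs_sign_of_ne_zero (by omega)
    have habs := congrArg Int.natAbs hkl'
    rw [Int.natAbs_mul, Int.natAbs_mul, hk2, hl2, one_mul, one_mul] at habs
    have hij := hv.2 habs
    have hne : v ⟨k.1.natAbs - 1, hidx k⟩ ≠ 0 := by
      have := (hv.1 ⟨k.1.natAbs - 1, hidx k⟩).1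
      omega
    rw [← hij] at hkl'
    have hsign := mul_right_cancel₀ hne hkl'
    rw [Fin.mk.injEq] at hij
    have hnat : k.1.natAbs = l.1.natAbs := by omega
    apply Subtype.ext
    rw [← Int.sign_mul_natAbs k.1, ← Int.sign_mul_natAbs l.1, hsign, hnat]
  refine ⟨Equiv.ofBijective _ (Finite.injective_iff_bijective.1 hinj), ?_, fun i => ?_⟩
  · refine mem_filter.2 ⟨mem_univ _, fun k => Subtype.ext ?_⟩
    simp [negPM, Equiv.ofBijective_apply]
  · rw [window_succ]
    simp only [Equiv.ofBijective_apply]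
    rw [Int.sign_natCast_of_ne_zero (by omega), one_mul]
    congr 1

/-- A window is a permutation with an independent choice of signs, so the sum over signs of a
product is a product of two-term sums. -/
theorem sum_prod_window {R : Type*} [CommRing R] {n : ℕ} (g : Fin n → ℤ → R) :
    ∑ σ ∈ B n, ∏ i : Fin n, g i (window σ (i + 1)) =
      ∑ e : Equiv.Perm (Fin n), ∏ i, (g i ((e i : ℕ) + 1) + g i (-((e i : ℕ) + 1))) := by
  let u : Equiv.Perm (Fin n) × (Fin n → Bool) → Fin n → ℤ := fun x i =>
    if x.2 i then ((x.1 i : ℕ) + 1 : ℤ) else -((x.1 i : ℕ) + 1 : ℤ)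
  have habs : ∀ x i, (u x i).natAbs = x.1 i + 1 := fun x i => by
    simp only [u]
    split_ifs <;> omega
  have hu : ∀ x, IsWindow (u x) := fun x => by
    refine ⟨fun i => ?_, fun i j hij => ?_⟩
    · rw [habs]
      omega
    · simp only [habs] at hij
      exact x.1.injective (Fin.ext (by omega))
  choose F hF hFw using fun x => exists_window_eq (hu x)
  have hR : ∀ e : Equiv.Perm (Fin n), ∏ i, (g i ((e i : ℕ) + 1) + g i (-((e i : ℕ) + 1))) =
      ∑ s : Fin n → Bool, ∏ i, g i (u (e, s) i) := by
    intro e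
    have := prod_univ_sum (fun _ : Fin n => (univ : Finset Bool))
      (fun i b => g i (if b then ((e i : ℕ) + 1 : ℤ) else -((e i : ℕ) + 1 : ℤ)))
    rw [Fintype.piFinset_univ] at this
    simp only [Fintype.sum_bool, if_true, Bool.false_eq_true, if_false] at this
    exact this
  simp_rw [hR]
  rw [← Fintype.sum_prod_type (fun x => ∏ i, g i (u x i))]
  symm
  refine sum_bij (fun x _ => F x) (fun x _ => hF x) ?_ ?_ ?_
  · intro x _ y _ hxy
    have huu : u x = u y := by
      ext i
      rw [← hFw, ← hFw, hxy]
    have h1 : x.1 = y.1 := by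
      ext i
      have := habs x i
      rw [huu, habs] at this
      omega
    have h2 : x.2 = y.2 := by
      ext i
      have := congrFun huu i
      simp only [u, h1] at this
      by_cases hx : x.2 i <;> by_cases hy : y.2 i <;> simp_all <;> omega
    exact Prod.ext h1 h2
  · intro σ hσ
    have hw := isWindow_window hσ
    have hinj : Function.Injective fun i : Fin n =>
        (⟨(window σ (i + 1)).natAbs - 1, by have := hw.1 i; simp only at this; omega⟩ : Fin n) := by
      intro i j hij
      apply hw.2
      have h1 := hw.1 i
      have h2 := hw.1 j
      simp only [Fin.mk.injEq] at hij h1 h2 ⊢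
      omega
    refine ⟨(Equiv.ofBijective _ (Finite.injective_iff_bijective.1 hinj),
      fun i => decide (0 < window σ (i + 1))), mem_univ _, eq_of_window_eq (hF _) hσ fun i => ?_⟩
    rw [hFw]
    have h1 := hw.1 i
    simp only [u, Equiv.ofBijective_apply, decide_eq_true_eq] at h1 ⊢
    split_ifs <;> omega
  · intro x _
    simp [hFw]

theorem card_descentClass {n : ℕ} {I : Finset ℕ} (hI : I ⊆ range n) :
    #(descentClass n I) = #(patternWords [0] (· ∈ I) (Icc 1 n)) := by
  classical
  have hlist : ∀ (σ : Equiv.Perm (pmSet n)) (i : ℕ) (h : i < (0 :: List.ofFn fun j : Fin n =>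
      window σ (j + 1)).length), (0 :: List.ofFn fun j : Fin n => window σ (j + 1))[i] =
        window σ i := by
    intro σ i h
    cases i with
    | zero => simp [window]
    | succ i => simp
  have hpat : ∀ σ : Equiv.Perm (pmSet n), HasDescentPattern (· ∈ I)
      ([0] ++ List.ofFn fun j : Fin n => window σ (j + 1)) ↔ descentSet σ = I := by
    intro σ
    rw [List.singleton_append, hasDescentPattern_iff_getElem]
    simp only [hlist]
    simp only [List.length_cons, List.length_ofFn, add_lt_add_iff_right]
    constructor
    · intro h
      ext i
      simp only [descentSet, mem_filter, mem_range]
      constructor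
      · rintro ⟨h1, h2⟩
        exact (h i h1).1 h2
      · intro hi
        have h1 := mem_range.1 (hI hi)
        exact ⟨h1, (h i h1).2 hi⟩
    · rintro rfl i hi
      simp [descentSet, hi]
  refine card_bij (fun σ _ => List.ofFn fun j : Fin n => window σ (j + 1)) ?_ ?_ ?_
  · intro σ hσ
    rw [descentClass, mem_filter] at hσ
    rw [patternWords, mem_filter, hpat]
    refine ⟨mem_signedWords.2 ?_, hσ.2⟩
    have hw := isWindow_window hσ.1
    rw [List.map_ofFn]
    have hnd := List.nodup_ofFn_ofInjective hw.2
    have hsub : (⟨_, Multiset.coe_nodup.2 hnd⟩ : Finset ℕ) ⊆ Icc 1 n := by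
      intro k hk
      rw [← mem_val] at hk
      obtain ⟨i, rfl⟩ := (List.mem_ofFn' _ _).1 (Multiset.mem_coe.1 hk)
      exact mem_Icc.2 (hw.1 i)
    exact congrArg val (eq_of_subset_of_card_le hsub (by simp [card_mk]))
  · intro σ hσ τ hτ h
    exact eq_of_window_eq (mem_filter.1 hσ).1 (mem_filter.1 hτ).1 (congrFun (List.ofFn_injective h))
  · intro w hw
    rw [patternWords, mem_filter] at hw
    obtain ⟨hw, hp⟩ := hw
    have hlen : w.length = n := by simpa using length_of_mem_signedWords hw
    have hv : IsWindow fun i : Fin n => w[i] := by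
      refine ⟨fun i => ?_, fun i j hij => ?_⟩
      · exact mem_Icc.1 (natAbs_mem_of_mem_signedWords hw (List.getElem_mem _))
      · have hnd := (mem_signedWords_iff.1 hw).1
        apply Fin.ext
        refine (List.Nodup.getElem_inj_iff hnd (hi := by simp [hlen]) (hj := by simp [hlen])).1 ?_
        simpa using hij
    obtain ⟨σ, hσ, hσw⟩ := exists_window_eq hv
    have hof : (List.ofFn fun j : Fin n => window σ (j + 1)) = w := by
      simp only [hσw]
      refine List.ext_getElem (by simp [hlen]) fun i h1 h2 => by simp
    refine ⟨σ, mem_filter.2 ⟨hσ, ?_⟩, hof⟩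
    rw [← hpat, hof]
    exact hp

theorem hasDescentPattern_congr {χ χ' : ℕ → Prop} {l : List ℤ}
    (h : ∀ i, i + 1 < l.length → (χ i ↔ χ' i)) :
    HasDescentPattern χ l ↔ HasDescentPattern χ' l := by
  simp only [hasDescentPattern_iff_getElem]
  exact forall₂_congr fun i hi => by rw [h i hi]

theorem springer_eq_springerValue (n : ℕ) : (springer n : ℤ) = springerValue n := by
  classical
  have hpos : ∀ x ∈ Icc 1 n, 0 < x := fun x hx => (mem_Icc.1 hx).1
  apply le_antisymm
  · obtain ⟨I, hI, hs⟩ := exists_mem_eq_sup (range n).powerset ⟨∅, by simp⟩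
      fun I => #(descentClass n I)
    rw [springer, hs, card_descentClass (mem_powerset.1 hI)]
    exact (card_patternWords_zero n _ _ (by simp) hpos).1
  -- The even positions form an alternating descent set; beyond `n` the pattern is never inspected,
  -- so `Even` can replace it.
  · have hsub : (range n).filter Even ⊆ range n := filter_subset _ _
    have h1 : #(descentClass n ((range n).filter Even)) ≤ springer n :=
      le_sup (f := fun I => #(descentClass n I)) (mem_powerset.2 hsub)
    have h2 : patternWords [0] (· ∈ (range n).filter Even) (Icc 1 n) =
        patternWords [0] Even (Icc 1 n) := by
      refine filter_congr fun w hw => hasDescentPattern_congr fun i hi => ?_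
      have hlen : w.length = n := by simpa using length_of_mem_signedWords hw
      simp only [List.singleton_append, List.length_cons, hlen, add_lt_add_iff_right] at hi
      simp [hi]
    rw [card_descentClass hsub, h2] at h1
    rw [← (card_patternWords_zero n (Icc 1 n) Even (by simp) hpos).2 fun i => Nat.even_add_one]
    exact_mod_cast h1

/-! ### Evaluation at `I` and extraction of the two sums -/

open Complex in
/-- The contribution of `σ_i = k` to `I ^ fwex σ`, with `0` for a fixed point. -/
noncomputable def fwexFactor (i : ℕ) (k : ℤ) : ℂ :=
  if k = i then 0 else (if (i : ℤ) ≤ k then I ^ 2 else 1) * (if k < 0 then I else 1)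

theorem prod_fwexFactor {n : ℕ} (σ : Equiv.Perm (pmSet n)) :
    ∏ i ∈ Icc 1 n, fwexFactor i (window σ i) =
      if fixedPts σ = ∅ then Complex.I ^ fwex σ else 0 := by
  split_ifs with h
  · have : ∀ i ∈ Icc 1 n, fwexFactor i (window σ i) =
        (if (i : ℤ) ≤ window σ i then Complex.I ^ 2 else 1) *
          (if window σ i < 0 then Complex.I else 1) := by
      intro i hi
      refine if_neg fun h' => ?_
      have : i ∈ fixedPts σ := mem_filter.2 ⟨hi, h'⟩
      simp [h] at this
    rw [prod_congr rfl this, prod_mul_distrib, prod_ite, prod_ite]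
    simp [fwex, wex, neg, pow_add, pow_mul]
  · obtain ⟨i, hi⟩ := nonempty_iff_ne_empty.2 h
    obtain ⟨h1, h2⟩ := mem_filter.1 hi
    exact prod_eq_zero h1 (if_pos h2)

/-- The three cases are `-1 + I = I * (1 + I)`, `0 + I = I * 1` and `1 + I = I * (1 - I)`; the
vanishing factor at fixed points produces the middle one. -/
theorem fwexFactor_add {n : ℕ} (i j : Fin n) :
    fwexFactor (i + 1) ((j : ℕ) + 1) + fwexFactor (i + 1) (-((j : ℕ) + 1)) =
      Complex.I * (excedanceWeight i j).eval 1 := by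
  have hI := Complex.I_mul_I
  have h1 : ¬ (-((j : ℕ) + 1 : ℤ) = ((i + 1 : ℕ) : ℤ)) := by omega
  have h2 : ¬ (((i + 1 : ℕ) : ℤ) ≤ -((j : ℕ) + 1 : ℤ)) := by omega
  have h3 : -((j : ℕ) + 1 : ℤ) < 0 := by omega
  have h4 : ¬ (((j : ℕ) + 1 : ℤ) < 0) := by omega
  simp only [fwexFactor, excedanceWeight, h1, h2, h3, h4, if_true, if_false, one_mul, mul_one]
  rcases lt_trichotomy i j with h | h | h
  · have h5 : ¬ (((j : ℕ) + 1 : ℤ) = ((i + 1 : ℕ) : ℤ)) := by omega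
    have h6 : ((i + 1 : ℕ) : ℤ) ≤ ((j : ℕ) + 1 : ℤ) := by omega
    rw [if_neg h5, if_pos h6, if_pos h]
    simp
    linear_combination -hI
  · subst h
    simp
  · have h5 : ¬ (((j : ℕ) + 1 : ℤ) = ((i + 1 : ℕ) : ℤ)) := by omega
    have h6 : ¬ (((i + 1 : ℕ) : ℤ) ≤ ((j : ℕ) + 1 : ℤ)) := by omega
    rw [if_neg h5, if_neg h6, if_neg h.not_gt, if_pos h]
    simp
    linear_combination hI

theorem sum_BStar_I_pow_fwex (n : ℕ) :
    ∑ σ ∈ BStar n, Complex.I ^ fwex σ = Complex.I ^ n * (springer n : ℂ) := by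
  rw [BStar, sum_filter]
  simp_rw [← prod_fwexFactor]
  have hIcc : ∀ f : ℕ → ℂ, ∏ i ∈ Icc 1 n, f i = ∏ i : Fin n, f (i + 1) := by
    intro f
    rw [Fin.prod_univ_eq_prod_range (fun i => f (i + 1)) n, range_eq_Ico, prod_Ico_add' f 0 n 1]
    rfl
  simp_rw [hIcc]
  rw [sum_prod_window fun (i : Fin n) k => fwexFactor (i + 1) k]
  simp_rw [fwexFactor_add, prod_mul_distrib]
  rw [← mul_sum]
  simp only [prod_const, card_univ, Fintype.card_fin]
  congr 1
  have h := congrArg (Polynomial.eval 1) (sum_perm_prod_excedanceWeight n)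
  rw [Polynomial.eval_finsetSum] at h
  simp only [Polynomial.eval_prod] at h
  rw [h, Polynomial.eval_one_map]
  have := springer_eq_springerValue n
  rw [springerValue] at this
  rw [← this]
  simp

theorem neg_one_pow_eq_ofReal (m : ℕ) : (-1 : ℂ) ^ m = (((-1 : ℝ) ^ m : ℝ) : ℂ) := by
  push_cast
  rfl

theorem re_add_im_I_pow (k : ℕ) : (Complex.I ^ k).re + (Complex.I ^ k).im = (-1) ^ (k / 2) := by
  obtain ⟨m, rfl | rfl⟩ := k.even_or_odd'
  · rw [pow_mul, Complex.I_sq, Nat.mul_div_cancel_left _ two_pos, neg_one_pow_eq_ofReal,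
      Complex.ofReal_re, Complex.ofReal_im, add_zero]
  · have : (2 * m + 1) / 2 = m := by omega
    rw [pow_succ, pow_mul, Complex.I_sq, this, neg_one_pow_eq_ofReal, Complex.mul_I_re,
      Complex.mul_I_im, Complex.ofReal_re, Complex.ofReal_im, neg_zero, zero_add]

theorem re_I_pow (k : ℕ) : (Complex.I ^ k).re = if Even k then (-1) ^ (k / 2) else 0 := by
  obtain ⟨m, rfl | rfl⟩ := k.even_or_odd'
  · rw [pow_mul, Complex.I_sq, Nat.mul_div_cancel_left _ two_pos, if_pos (by simp),
      neg_one_pow_eq_ofReal, Complex.ofReal_re]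
  · rw [pow_succ, pow_mul, Complex.I_sq, if_neg (by simp), neg_one_pow_eq_ofReal,
      Complex.mul_I_re, Complex.ofReal_im, neg_zero]

theorem re_mul_natCast (z : ℂ) (m : ℕ) : (z * m).re = z.re * m := by simp

theorem im_mul_natCast (z : ℂ) (m : ℕ) : (z * m).im = z.im * m := by simp

theorem even_fwex {n : ℕ} (σ : Equiv.Perm (pmSet n)) : Even (fwex σ) ↔ Even (neg σ) := by
  simp [fwex, Nat.even_add]

theorem sum_BStar (n : ℕ) :
    ∑ σ ∈ BStar n, (-1 : ℤ) ^ (fwex σ / 2) = (-1 : ℤ) ^ (n / 2) * (springer n : ℤ) := by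
  have h := sum_BStar_I_pow_fwex n
  have hre := congrArg Complex.re h
  have him := congrArg Complex.im h
  rw [Complex.re_sum, re_mul_natCast] at hre
  rw [Complex.im_sum, im_mul_natCast] at him
  have := congrArg₂ (· + ·) hre him
  simp only [← sum_add_distrib, ← add_mul, re_add_im_I_pow] at this
  exact_mod_cast this

theorem sum_DStar (n : ℕ) :
    ∑ σ ∈ DStar n, (-1 : ℤ) ^ (fwex σ / 2) =
      if Even n then (-1 : ℤ) ^ (n / 2) * (springer n : ℤ) else 0 := by
  -- The real part kills the terms with `fwex σ` odd, leaving exactly `DStar n`.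
  have hre := congrArg Complex.re (sum_BStar_I_pow_fwex n)
  rw [Complex.re_sum, re_mul_natCast] at hre
  simp only [re_I_pow, even_fwex, ite_mul, zero_mul] at hre
  rw [← sum_filter] at hre
  have hD : DStar n = (BStar n).filter fun σ => Even (neg σ) := by
    rw [DStar, BStar, D, filter_comm]
  rw [hD]
  exact_mod_cast hre

end SignedPermutation

theorem corollary1p6 (n : ℕ) (hn : 1 ≤ n) :
    (∑ σ ∈ SignedPermutation.BStar n, (-1 : ℤ) ^ (SignedPermutation.fwex σ / 2)
        = (-1 : ℤ) ^ (n / 2) * (SignedPermutation.springer n : ℤ)) ∧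
    (∑ σ ∈ SignedPermutation.DStar n, (-1 : ℤ) ^ (SignedPermutation.fwex σ / 2)
        = if Even n then (-1 : ℤ) ^ (n / 2) * (SignedPermutation.springer n : ℤ) else 0) :=
  ⟨SignedPermutation.sum_BStar n, SignedPermutation.sum_DStar n⟩
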